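/- Let $d\ge 3$ and $s\ge 1$ be integers with $s\le\sqrt d$, and let $\sigma>0$. One observes $y_j=\theta_j+\sigma\xi_j$, $j=1,\dots,d$, where $\theta\in\mathbb R^d$ is unknown and the $\xi_j$ are i.i.d. standard normal; $\mathbf E_\theta$ denotes the corresponding expectation. Let $L(\theta)=\sum_{j=1}^d\theta_j$ and let $B_0(s)$ be the set of all $\theta\in\mathbb R^d$ with at most $s$ non-zero components. Let $y_{(1)}^2\le\dots\le y_{(d)}^2$ be the order statistics of $y_1^2,\dots,y_d^2$, and set $$\hat\sigma=3\Big(\frac1d\sum_{1\le j\le d-\sqrt d}y_{(j)}^2\Big)^{1/2},\qquad \tilde L=\sum_{j=1}^d y_j\,\mathbf 1\Big\{|y_j|>\hat\sigma\sqrt{2\log(1+d/s^2)}\Big\}.$$ Then there exists an absolute constant $C>0$ (not depending on $d$, $s$, $\sigma$) such that, for all such $d$, $s$ and $\sigma$, $$\sup_{\theta\in B_0(s)}\mathbf E_\theta\big(\tilde L-L(\theta)\big)^2\le C\,\sigma^2s^2\log(1+d/s^2).$$ -/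

import Mathlib

open MeasureTheory ProbabilityTheory
open scoped ENNReal

noncomputable section

namespace SparseMean

/-- The law `P_θ` of the observations `y_j = θ_j + σ ξ_j`, `j = 1, …, d`, where the `ξ_j` are
i.i.d. standard normal random variables. -/
def obsLaw {d : ℕ} (σ : ℝ) (θ : Fin d → ℝ) : Measure (Fin d → ℝ) :=
  (Measure.pi fun _ : Fin d => gaussianReal 0 1).map fun ξ j => θ j + σ * ξ j

/-- The class `B_0(s)` of vectors with at most `s` nonzero components. -/
def B0 (d s : ℕ) : Set (Fin d → ℝ) := {θ | hammingNorm θ ≤ s}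

/-- The linear functional `L(θ) = ∑ θ_j`. -/
def linFunctional {d : ℕ} (θ : Fin d → ℝ) : ℝ := ∑ j, θ j

/-- The order statistics of `y_1^2, …, y_d^2` in nondecreasing order. The index is 0-based: the
value at `j` is the `(j + 1)`-st smallest of the squares. -/
def sqOrderStat {d : ℕ} (y : Fin d → ℝ) (j : Fin d) : ℝ :=
  y (Tuple.sort (fun i => y i ^ 2) j) ^ 2

/-- The noise level over-estimator: `3` times the square root of `1 / d` times the sum of the
order statistics of the squares whose (1-based) rank is at most `d - √d`. -/
def sigmaHat {d : ℕ} (y : Fin d → ℝ) : ℝ :=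
  3 * √((1 / (d : ℝ)) *
    ∑ j : Fin d, if ((j : ℕ) : ℝ) + 1 ≤ (d : ℝ) - √(d : ℝ) then sqOrderStat y j else 0)

/-- The thresholding estimator of `L(θ)` with `σ` replaced by its over-estimator. -/
def linEstimator {d : ℕ} (s : ℕ) (y : Fin d → ℝ) : ℝ :=
  ∑ j, if sigmaHat y * √(2 * Real.log (1 + (d : ℝ) / (s : ℝ) ^ 2)) < |y j| then y j else 0

/-- The mean squared error `E_θ (T(y) - L(θ))^2`, as an element of `[0, ∞]`. -/
def sqRisk {d : ℕ} (σ : ℝ) (T : (Fin d → ℝ) → ℝ) (θ : Fin d → ℝ) : ℝ≥0∞ :=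
  ∫⁻ y, ENNReal.ofReal ((T y - linFunctional θ) ^ 2) ∂(obsLaw σ θ)

/-- The rate `σ^2 s^2 log (1 + d / s^2)`. -/
def linRate (σ : ℝ) (s d : ℕ) : ℝ :=
  σ ^ 2 * (s : ℝ) ^ 2 * Real.log (1 + (d : ℝ) / (s : ℝ) ^ 2)

end SparseMean

end

namespace SparseMean

/-! Split the error into support coordinates and null ones. On the at most `s` support coordinates,
thresholding costs at most noise plus threshold. Since `s ≤ √d`, at least `d - √d` coordinates are
null, so the trimmed sum in `sigmaHat` is at most a sum of pure noise (`sigmaHat_sq_le`), and the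
threshold has second moment of order `σ² log(1 + d/s²)`. By Cauchy-Schwarz this part contributes
`s²` times that.

On null coordinates the kept noises are pairwise uncorrelated: `sigmaHat` sees only squares, so
flipping the sign of one null noise changes nothing else (`integral_keptNoise_mul_eq_zero`). Only
their second moments remain. When `sigmaHat ≥ σ` each is a Gaussian tail beyond `t`, and `d *
exp(-t²/2) ≤ s²`. The event `sigmaHat < σ` is exponentially rare in `d`, by a Chernoff bound on the
number of null noises of size at least `2/3` (`one_le_prod_of_sigmaHat_lt`), which beats the factor
`d` (`exists_bound_overestimation`). -/

/-! ### Measurability of the order statistics and of `sigmaHat`. -/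

lemma measurable_sort {d : ℕ} (f : (Fin d → ℝ) → Fin d → ℝ) (hf : Measurable f)
    (π : Equiv.Perm (Fin d)) : MeasurableSet {y | Tuple.sort (f y) = π} := by
  have hf' : ∀ i, Measurable fun y => f y i := fun i => (measurable_pi_apply i).comp hf
  -- The sorting permutation is determined by finitely many comparisons: values nondecreasing along
  -- it, ties kept in index order.
  have h : {y | Tuple.sort (f y) = π} =
      (⋂ i, ⋂ j, ⋂ (_ : i ≤ j), {y | f y (π i) ≤ f y (π j)}) ∩
        ⋂ i, ⋂ j, ⋂ (_ : i < j), ⋂ (_ : ¬ π i < π j), {y | f y (π i) = f y (π j)}ᶜ := by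
    ext y
    simp only [Set.mem_ofPred_eq, Set.mem_inter_iff, Set.mem_iInter, Set.mem_compl_iff]
    rw [eq_comm, Tuple.eq_sort_iff]
    exact and_congr Iff.rfl (forall₃_congr fun i j _ => by rw [not_imp_not])
  rw [h]
  refine MeasurableSet.inter ?_ ?_
  · exact MeasurableSet.iInter fun i => MeasurableSet.iInter fun j => MeasurableSet.iInter fun _ =>
      measurableSet_le (hf' _) (hf' _)
  · exact MeasurableSet.iInter fun i => MeasurableSet.iInter fun j => MeasurableSet.iInter fun _ =>
      MeasurableSet.iInter fun _ => (measurableSet_eq_fun (hf' _) (hf' _)).compl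

lemma measurable_sqOrderStat {d : ℕ} (j : Fin d) :
    Measurable fun y : Fin d → ℝ => sqOrderStat y j := by
  have h : (fun y : Fin d → ℝ => sqOrderStat y j) = fun y => ∑ π : Equiv.Perm (Fin d),
      Set.indicator {y : Fin d → ℝ | Tuple.sort (fun i => y i ^ 2) = π}
        (fun y => y (π j) ^ 2) y := by
    funext y
    simp [sqOrderStat, Set.indicator_apply]
  rw [h]
  refine Finset.measurable_sum _ fun π _ => Measurable.indicator (by fun_prop) ?_
  exact measurable_sort (fun y i => y i ^ 2) (by fun_prop) π

@[fun_prop]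
lemma measurable_sigmaHat {d : ℕ} : Measurable (sigmaHat : (Fin d → ℝ) → ℝ) := by
  unfold sigmaHat
  refine Measurable.const_mul (Measurable.sqrt (Measurable.const_mul ?_ _)) _
  refine Finset.measurable_sum _ fun j _ => ?_
  split_ifs
  · exact measurable_sqOrderStat j
  · exact measurable_const

/-! ### Trimmed sums of order statistics. -/

lemma sum_sort_eq_sum_image {d : ℕ} (f : Fin d → ℝ) (p : Fin d → Prop) [DecidablePred p] :
    (∑ j, if p j then f (Tuple.sort f j) else 0) =
      ∑ i ∈ (Finset.univ.filter p).map (Tuple.sort f).toEmbedding, f i := by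
  rw [Finset.sum_map, Finset.sum_filter]
  rfl

/-- The sum of the smallest values is at most the sum over any other set which is at least as
large. -/
lemma sum_sort_le {d : ℕ} (f : Fin d → ℝ) (hf : ∀ i, 0 ≤ f i) (p : Fin d → Prop)
    [DecidablePred p] (hp : ∀ i j, i ≤ j → p j → p i) (T : Finset (Fin d))
    (hT : (Finset.univ.filter p).card ≤ T.card) :
    (∑ j, if p j then f (Tuple.sort f j) else 0) ≤ ∑ i ∈ T, f i := by
  classical
  rw [sum_sort_eq_sum_image]
  set A := (Finset.univ.filter p).map (Tuple.sort f).toEmbedding with hA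
  have hAc : A.card = (Finset.univ.filter p).card := Finset.card_map _
  have hle : ∀ i ∈ A, ∀ k ∉ A, f i ≤ f k := by
    intro i hi k hk
    obtain ⟨j, hj, rfl⟩ := Finset.mem_map.1 hi
    obtain ⟨l, rfl⟩ := (Tuple.sort f).surjective k
    have hl : ¬ p l := fun h => hk (Finset.mem_map.2 ⟨l, by simpa using h, rfl⟩)
    have hjl : j ≤ l := by
      by_contra h
      exact hl (hp l j (le_of_not_ge h) (by simpa using hj))
    exact Tuple.monotone_sort f hjl
  rw [← Finset.sum_inter_add_sum_sdiff A T, ← Finset.sum_inter_add_sum_sdiff T A,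
    Finset.inter_comm T A]
  refine add_le_add le_rfl ?_
  have hcard : (A \ T).card ≤ (T \ A).card :=
    Finset.card_sdiff_le_card_sdiff_iff.2 (hAc.trans_le hT)
  rcases (A \ T).eq_empty_or_nonempty with h0 | h0
  · rw [h0, Finset.sum_empty]
    exact Finset.sum_nonneg fun i _ => hf i
  · obtain ⟨m, hm, hmax⟩ := (A \ T).exists_max_image f h0
    calc ∑ i ∈ A \ T, f i ≤ (A \ T).card • f m := Finset.sum_le_card_nsmul _ _ _ hmax
      _ ≤ (T \ A).card • f m := by gcongr; exact hf m
      _ ≤ ∑ i ∈ T \ A, f i := Finset.card_nsmul_le_sum _ _ _ fun i hi =>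
        hle m (Finset.mem_sdiff.1 hm).1 i (Finset.mem_sdiff.1 hi).2

/-- Discarding the ranks outside `p` removes at most that many members of `N`; each survivor
contributes at least `a`. -/
lemma le_sum_sort {d : ℕ} (f : Fin d → ℝ) (hf : ∀ i, 0 ≤ f i) (p : Fin d → Prop)
    [DecidablePred p] (N : Finset (Fin d)) (a : ℝ) (ha : 0 ≤ a) (hN : ∀ i ∈ N, a ≤ f i) :
    a * ((N.card : ℝ) - (Finset.univ.filter fun j => ¬ p j).card) ≤
      ∑ j, if p j then f (Tuple.sort f j) else 0 := by
  classical
  rw [sum_sort_eq_sum_image]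
  set A := (Finset.univ.filter p).map (Tuple.sort f).toEmbedding with hA
  have hAc : A.card = (Finset.univ.filter p).card := Finset.card_map _
  have h1 : (Finset.univ.filter p).card + (Finset.univ.filter fun j => ¬ p j).card = d := by
    rw [Finset.card_filter_add_card_filter_not]; simp
  have h2 : (N ∩ A).card + (N \ A).card = N.card := Finset.card_inter_add_card_sdiff _ _
  have h3 : (N \ A).card ≤ Aᶜ.card := Finset.card_le_card fun i hi => by
    simp at hi ⊢; exact hi.2
  rw [Finset.card_compl, Fintype.card_fin] at h3
  have h4 : N.card ≤ (N ∩ A).card + (Finset.univ.filter fun j => ¬ p j).card := by omega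
  have h5 : (N.card : ℝ) ≤ (N ∩ A).card + (Finset.univ.filter fun j => ¬ p j).card := by
    exact_mod_cast h4
  calc a * ((N.card : ℝ) - (Finset.univ.filter fun j => ¬ p j).card)
      ≤ a * (N ∩ A).card := by gcongr; linarith
    _ = ∑ i ∈ N ∩ A, a := by simp [mul_comm]
    _ ≤ ∑ i ∈ N ∩ A, f i := Finset.sum_le_sum fun i hi => hN i (Finset.mem_inter.1 hi).1
    _ ≤ ∑ i ∈ A, f i := Finset.sum_le_sum_of_subset_of_nonneg Finset.inter_subset_right
        fun i _ _ => hf i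

lemma sqrt_natCast_le (d : ℕ) : √(d : ℝ) ≤ d := by
  rcases Nat.eq_zero_or_pos d with rfl | h
  · simp
  · have : (1 : ℝ) ≤ d := by exact_mod_cast h
    exact Real.sqrt_le_iff.2 ⟨by linarith, by nlinarith⟩

lemma card_rank_le (d : ℕ) :
    (Finset.univ.filter fun j : Fin d =>
      ((j : ℕ) : ℝ) + 1 ≤ (d : ℝ) - √(d : ℝ)).card = ⌊(d : ℝ) - √(d : ℝ)⌋₊ := by
  have h0 : 0 ≤ (d : ℝ) - √(d : ℝ) := sub_nonneg.2 (sqrt_natCast_le d)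
  have h : ∀ j : Fin d, ((j : ℕ) : ℝ) + 1 ≤ (d : ℝ) - √(d : ℝ) ↔
      (j : ℕ) < ⌊(d : ℝ) - √(d : ℝ)⌋₊ := fun j => by
    rw [← Nat.succ_le_iff, Nat.le_floor_iff h0]
    simp
  simp_rw [h]
  rw [Fin.card_filter_val_lt, min_eq_right]
  exact Nat.floor_le_of_le (by linarith [Real.sqrt_nonneg (d : ℝ)])

lemma card_rank_gt_le (d : ℕ) :
    ((Finset.univ.filter fun j : Fin d =>
      ¬ ((j : ℕ) : ℝ) + 1 ≤ (d : ℝ) - √(d : ℝ)).card : ℝ) ≤ √(d : ℝ) + 1 := by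
  have h := Finset.card_filter_add_card_filter_not (s := Finset.univ)
    fun j : Fin d => ((j : ℕ) : ℝ) + 1 ≤ (d : ℝ) - √(d : ℝ)
  rw [card_rank_le, Finset.card_univ, Fintype.card_fin] at h
  have h' := congrArg (Nat.cast (R := ℝ)) h
  push_cast at h'
  linarith [Nat.lt_floor_add_one ((d : ℝ) - √(d : ℝ))]

/-! ### One-dimensional Gaussian estimates. -/

lemma integrable_sq_gaussian : Integrable (fun u : ℝ => u ^ 2) (gaussianReal 0 1) :=
  (memLp_id_gaussianReal (μ := 0) (v := 1) 2).integrable_sq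

lemma integral_sq_gaussian : ∫ u, u ^ 2 ∂(gaussianReal 0 1) = 1 := by
  have h := variance_eq_integral (μ := gaussianReal 0 1) (X := fun u => u) (by fun_prop)
  rw [variance_fun_id_gaussianReal, integral_id_gaussianReal] at h
  simpa using h.symm

lemma hasDerivAt_neg_mul_gaussianPDF (u : ℝ) :
    HasDerivAt (fun u => -(u * gaussianPDFReal 0 1 u)) ((u ^ 2 - 1) * gaussianPDFReal 0 1 u) u := by
  have h1 : HasDerivAt (fun u : ℝ => -(u - 0) ^ 2 / (2 * (1 : ℝ))) (-u) u := by
    have h := (((hasDerivAt_id u).pow 2).neg).div_const 2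
    refine (h.congr_deriv ?_).congr_of_eventuallyEq ?_
    · simp
      ring
    · exact Filter.Eventually.of_forall fun v => by simp
  have h2 := (h1.exp.const_mul (√(2 * Real.pi * (1 : ℝ)))⁻¹)
  have h3 := ((hasDerivAt_id u).mul h2).neg
  refine (h3.congr_deriv ?_).congr_of_eventuallyEq ?_
  · simp [gaussianPDFReal_def]
    ring
  · exact Filter.Eventually.of_forall fun v => by simp [gaussianPDFReal_def]

lemma gaussianPDF_le_exp (u : ℝ) : gaussianPDFReal 0 1 u ≤ 2 / 5 * Real.exp (-(u ^ 2 / 2)) := by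
  have h : (√(2 * Real.pi))⁻¹ ≤ 2 / 5 := by
    rw [inv_le_comm₀ (by positivity) (by norm_num)]
    exact Real.le_sqrt_of_sq_le (by norm_num; linarith [Real.pi_gt_d2])
  have h2 : gaussianPDFReal 0 1 u = (√(2 * Real.pi))⁻¹ * Real.exp (-(u ^ 2 / 2)) := by
    simp [gaussianPDFReal_def, neg_div]
  rw [h2]
  gcongr

lemma tendsto_neg_mul_gaussianPDF :
    Filter.Tendsto (fun u => -(u * gaussianPDFReal 0 1 u)) Filter.atTop (nhds 0) := by
  suffices h : Filter.Tendsto (fun u => u * gaussianPDFReal 0 1 u) Filter.atTop (nhds 0) by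
    simpa using h.neg
  have h : Filter.Tendsto (fun u : ℝ => u ^ 1 * Real.exp (-u)) Filter.atTop (nhds 0) :=
    Real.tendsto_pow_mul_exp_neg_atTop_nhds_zero 1
  refine squeeze_zero' ?_ ?_ h
  · filter_upwards [Filter.eventually_ge_atTop 0] with u hu
    exact mul_nonneg hu (gaussianPDFReal_nonneg 0 1 u)
  · filter_upwards [Filter.eventually_ge_atTop 2] with u hu
    rw [pow_one]
    refine mul_le_mul_of_nonneg_left ?_ (by linarith)
    have h1 := gaussianPDF_le_exp u
    have h2 : Real.exp (-(u ^ 2 / 2)) ≤ Real.exp (-u) := Real.exp_le_exp.2 (by nlinarith)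
    linarith [Real.exp_pos (-u), Real.exp_pos (-(u ^ 2 / 2))]

/-- With `φ` the density, `(u² - 1)φ` is the derivative of `-uφ`, and `u² ≤ 4(u² - 1)` once `u² ≥
4/3`. The two tails give `8tφ(t)`, and `8 * (2/5) ≤ 4`. -/
lemma integral_sq_tail_gaussian_le {t : ℝ} (ht0 : 0 < t) (ht : 4 / 3 ≤ t ^ 2) :
    ∫ u, (if t < |u| then u ^ 2 else 0) ∂(gaussianReal 0 1) ≤ 4 * t * Real.exp (-(t ^ 2 / 2)) := by
  have hpos : ∀ u ∈ Set.Ioi t, 0 ≤ (u ^ 2 - 1) * gaussianPDFReal 0 1 u := fun u hu => by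
    have : t < u := hu
    exact mul_nonneg (by nlinarith) (gaussianPDFReal_nonneg 0 1 u)
  have hint := integrableOn_Ioi_deriv_of_nonneg' (fun u _ => hasDerivAt_neg_mul_gaussianPDF u) hpos
    tendsto_neg_mul_gaussianPDF
  have hval := integral_Ioi_of_hasDerivAt_of_nonneg' (fun u _ => hasDerivAt_neg_mul_gaussianPDF u)
    hpos tendsto_neg_mul_gaussianPDF
  have key : ∫ u, (if t < |u| then u ^ 2 else 0) ∂(gaussianReal 0 1) =
      2 * ∫ u in Set.Ioi t, u ^ 2 * gaussianPDFReal 0 1 u := by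
    rw [integral_gaussianReal_eq_integral_smul one_ne_zero]
    have h1 : ∀ u : ℝ, gaussianPDFReal 0 1 u • (if t < |u| then u ^ 2 else 0) =
        (fun v => if t < v then v ^ 2 * gaussianPDFReal 0 1 v else 0) |u| := fun u => by
      simp [gaussianPDFReal_def, mul_comm]
    rw [integral_congr_ae (Filter.Eventually.of_forall h1),
      integral_comp_abs (f := fun v => if t < v then v ^ 2 * gaussianPDFReal 0 1 v else 0)]
    congr 1
    have h2 : (fun v => if t < v then v ^ 2 * gaussianPDFReal 0 1 v else 0) =
        (Set.Ioi t).indicator fun v => v ^ 2 * gaussianPDFReal 0 1 v := by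
      funext v; simp [Set.indicator_apply]
    rw [h2, setIntegral_indicator measurableSet_Ioi, Set.inter_eq_right.2]
    exact Set.Ioi_subset_Ioi ht0.le
  rw [key]
  have hle : ∫ u in Set.Ioi t, u ^ 2 * gaussianPDFReal 0 1 u ≤
      ∫ u in Set.Ioi t, 4 * ((u ^ 2 - 1) * gaussianPDFReal 0 1 u) := by
    refine integral_mono_of_nonneg (Filter.Eventually.of_forall fun u =>
      mul_nonneg (sq_nonneg u) (gaussianPDFReal_nonneg 0 1 u)) (hint.const_mul 4) ?_
    refine (ae_restrict_iff' measurableSet_Ioi).2 (Filter.Eventually.of_forall fun u hu => ?_)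
    have : t < u := hu
    have h3 : u ^ 2 ≤ 4 * (u ^ 2 - 1) := by nlinarith
    calc u ^ 2 * gaussianPDFReal 0 1 u ≤ 4 * (u ^ 2 - 1) * gaussianPDFReal 0 1 u :=
          mul_le_mul_of_nonneg_right h3 (gaussianPDFReal_nonneg 0 1 u)
      _ = _ := by ring
  rw [integral_const_mul, hval] at hle
  have h4 := mul_le_mul_of_nonneg_left (gaussianPDF_le_exp t) ht0.le
  have h5 : 0 < t * Real.exp (-(t ^ 2 / 2)) := by positivity
  nlinarith

/-- The one-coordinate Chernoff factor: it equals `1/2 + P(|u| < 2/3)/2`, and bounding the density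
by `2/5` gives `1/2 + 4/15 < 77/100`. -/
lemma integral_half_gaussian_le :
    ∫ u, (if 2 / 3 ≤ |u| then (1 / 2 : ℝ) else 1) ∂(gaussianReal 0 1) ≤ 77 / 100 := by
  have hm : MeasurableSet (Set.Ioo (-(2 / 3)) (2 / 3 : ℝ)) := measurableSet_Ioo
  have h1 : ∀ u : ℝ, (if 2 / 3 ≤ |u| then (1 / 2 : ℝ) else 1) =
      1 / 2 + (Set.Ioo (-(2 / 3)) (2 / 3 : ℝ)).indicator (fun _ => (1 / 2 : ℝ)) u := fun u => by
    simp only [Set.indicator_apply, Set.mem_Ioo, ← abs_lt]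
    by_cases h : 2 / 3 ≤ |u|
    · simp [h, not_lt.2 h]
    · simp [h, not_le.1 h]; norm_num
  simp_rw [h1]
  rw [integral_add (integrable_const _) ((integrable_const _).indicator hm),
    integral_indicator_const _ hm, integral_const, probReal_univ, measureReal_def,
    gaussianReal_apply_eq_integral 0 one_ne_zero, ENNReal.toReal_ofReal
      (integral_nonneg fun u => gaussianPDFReal_nonneg 0 1 u)]
  have h2 : ∫ u in Set.Ioo (-(2 / 3)) (2 / 3 : ℝ), gaussianPDFReal 0 1 u ≤
      ∫ u in Set.Ioo (-(2 / 3)) (2 / 3 : ℝ), (2 / 5 : ℝ) := by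
    refine setIntegral_mono (integrable_gaussianPDFReal 0 1).integrableOn ?_ fun u => ?_
    · exact integrableOn_const (by simp)
    · have h := gaussianPDF_le_exp u
      have h' : Real.exp (-(u ^ 2 / 2)) ≤ 1 := Real.exp_le_one_iff.2 (by nlinarith [sq_nonneg u])
      linarith
  rw [setIntegral_const, measureReal_def, Real.volume_Ioo] at h2
  rw [ENNReal.toReal_ofReal (by norm_num)] at h2
  simp only [smul_eq_mul] at h2 ⊢
  linarith

/-! ### Symmetry and independence under the product Gaussian law. -/

/-- An integrable function which is odd in one coordinate has mean zero under a standard Gaussian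
product measure. -/
lemma integral_eq_zero_of_odd {d : ℕ} (j : Fin d) (G : (Fin d → ℝ) → ℝ) (hG : Measurable G)
    (hodd : ∀ ξ, G (Function.update ξ j (-ξ j)) = -G ξ) :
    ∫ ξ, G ξ ∂(Measure.pi fun _ : Fin d => gaussianReal 0 1) = 0 := by
  have hflip : MeasurePreserving (fun (ξ : Fin d → ℝ) i => (if i = j then Neg.neg else id) (ξ i))
      (Measure.pi fun _ : Fin d => gaussianReal 0 1)
      (Measure.pi fun _ : Fin d => gaussianReal 0 1) := by
    refine measurePreserving_pi _ _ fun i => ?_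
    split_ifs
    · exact ⟨measurable_neg, by simpa using gaussianReal_map_neg (μ := 0) (v := 1)⟩
    · exact MeasurePreserving.id _
  have heq : (fun (ξ : Fin d → ℝ) i => (if i = j then Neg.neg else id) (ξ i)) =
      fun ξ => Function.update ξ j (-ξ j) := by
    funext ξ i
    by_cases h : i = j
    · subst h; simp
    · simp [h]
  rw [heq] at hflip
  -- Valid without integrability, since the Bochner integral then defaults to 0.
  have h := integral_map (μ := Measure.pi fun _ : Fin d => gaussianReal 0 1)
    hflip.measurable.aemeasurable hG.aestronglyMeasurable
  rw [hflip.map_eq] at h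
  simp_rw [hodd, integral_neg] at h
  linarith

/-- A weighted moment bound obtained by independence. -/
lemma integral_sq_mul_prod_half_le {d : ℕ} (j : Fin d) (T : Finset (Fin d)) (hj : j ∈ T) :
    Integrable (fun ξ : Fin d → ℝ => ξ j ^ 2 *
        ∏ i ∈ T.erase j, if 2 / 3 ≤ |ξ i| then (1 / 2 : ℝ) else 1)
      (Measure.pi fun _ : Fin d => gaussianReal 0 1) ∧
    ∫ ξ, (ξ j ^ 2 * ∏ i ∈ T.erase j, if 2 / 3 ≤ |ξ i| then (1 / 2 : ℝ) else 1)
      ∂(Measure.pi fun _ : Fin d => gaussianReal 0 1) ≤ (77 / 100) ^ (T.card - 1) := by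
  set f : Fin d → ℝ → ℝ := fun i u => if i = j then u ^ 2 else
    if i ∈ T then (if 2 / 3 ≤ |u| then (1 / 2 : ℝ) else 1) else 1 with hf
  have heq : (fun ξ : Fin d → ℝ => ξ j ^ 2 *
      ∏ i ∈ T.erase j, if 2 / 3 ≤ |ξ i| then (1 / 2 : ℝ) else 1) = fun ξ => ∏ i, f i (ξ i) := by
    funext ξ
    rw [← Finset.mul_prod_erase _ _ (Finset.mem_univ j)]
    congr 1
    · simp [hf]
    · rw [← Finset.prod_subset (Finset.erase_subset_erase j (Finset.subset_univ T))]
      · refine Finset.prod_congr rfl fun i hi => ?_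
        simp [hf, Finset.ne_of_mem_erase hi, Finset.mem_of_mem_erase hi]
      · intro i hi hi'
        have hij := Finset.ne_of_mem_erase hi
        have : i ∉ T := fun h => hi' (Finset.mem_erase.2 ⟨hij, h⟩)
        simp [hf, hij, this]
  have hmeas : Measurable fun u : ℝ => if 2 / 3 ≤ |u| then (1 / 2 : ℝ) else 1 :=
    Measurable.ite (measurableSet_le measurable_const measurable_id.abs) measurable_const
      measurable_const
  have hint : ∀ i, Integrable (f i) (gaussianReal 0 1) := by
    intro i
    by_cases h : i = j
    · simpa [hf, h] using integrable_sq_gaussian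
    by_cases h' : i ∈ T
    · simp only [hf, h, h', if_true, if_false]
      refine Integrable.of_bound hmeas.aestronglyMeasurable 1 (Filter.Eventually.of_forall fun u => ?_)
      split_ifs <;> norm_num
    · simp [hf, h, h']
  refine ⟨heq ▸ Integrable.fintype_prod hint, ?_⟩
  rw [heq, integral_fintype_prod_eq_prod, ← Finset.mul_prod_erase _ _ (Finset.mem_univ j)]
  have h1 : ∫ u, f j u ∂(gaussianReal 0 1) = 1 := by simpa [hf] using integral_sq_gaussian
  rw [h1, one_mul, ← Finset.prod_subset (Finset.erase_subset_erase j (Finset.subset_univ T)),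
    ← Finset.card_erase_of_mem hj]
  · rw [← Finset.prod_const]
    refine Finset.prod_le_prod (fun i _ => integral_nonneg fun u => ?_) fun i hi => ?_
    · simp only [hf]
      split_ifs <;> positivity
    · simpa [hf, Finset.ne_of_mem_erase hi, Finset.mem_of_mem_erase hi] using
        integral_half_gaussian_le
  · intro i hi hi'
    have hij := Finset.ne_of_mem_erase hi
    have : i ∉ T := fun h => hi' (Finset.mem_erase.2 ⟨hij, h⟩)
    simp [hf, hij, this]

/-! ### Upper and lower control of `sigmaHat`. -/

lemma sigmaHat_nonneg {d : ℕ} (y : Fin d → ℝ) : 0 ≤ sigmaHat y := by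
  unfold sigmaHat
  positivity

lemma sigmaHat_congr {d : ℕ} {y z : Fin d → ℝ} (h : ∀ i, y i ^ 2 = z i ^ 2) :
    sigmaHat y = sigmaHat z := by
  have hs : (fun i => y i ^ 2) = fun i => z i ^ 2 := funext h
  have ho : ∀ j, sqOrderStat y j = sqOrderStat z j := fun j => by
    unfold sqOrderStat
    rw [hs, h]
  unfold sigmaHat
  simp_rw [ho]

lemma sigmaHat_sq {d : ℕ} (y : Fin d → ℝ) :
    sigmaHat y ^ 2 = 9 / (d : ℝ) *
      ∑ j : Fin d, if ((j : ℕ) : ℝ) + 1 ≤ (d : ℝ) - √(d : ℝ) then sqOrderStat y j else 0 := by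
  unfold sigmaHat
  rw [mul_pow, Real.sq_sqrt]
  · ring
  · refine mul_nonneg (by positivity) (Finset.sum_nonneg fun j _ => ?_)
    split_ifs
    · exact sq_nonneg _
    · exact le_rfl

/-- The coordinates outside the support. -/
noncomputable def nullSet {d : ℕ} (θ : Fin d → ℝ) : Finset (Fin d) := Finset.univ.filter fun j => θ j = 0

lemma hammingNorm_add_card_nullSet {d : ℕ} (θ : Fin d → ℝ) :
    hammingNorm θ + (nullSet θ).card = d := by
  unfold hammingNorm nullSet
  rw [add_comm, Finset.card_filter_add_card_filter_not]
  simp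

lemma le_card_nullSet {d : ℕ} {θ : Fin d → ℝ} (hθ : (hammingNorm θ : ℝ) ≤ √(d : ℝ)) :
    (d : ℝ) - √(d : ℝ) ≤ (nullSet θ).card := by
  have h := congrArg (Nat.cast (R := ℝ)) (hammingNorm_add_card_nullSet θ)
  push_cast at h
  linarith

lemma sigmaHat_sq_le {d : ℕ} {θ : Fin d → ℝ} (hθ : (hammingNorm θ : ℝ) ≤ √(d : ℝ)) (σ : ℝ)
    (ξ : Fin d → ℝ) :
    sigmaHat (fun j => θ j + σ * ξ j) ^ 2 ≤ 9 * σ ^ 2 / d * ∑ j, ξ j ^ 2 := by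
  rw [sigmaHat_sq]
  have hcard : (Finset.univ.filter fun j : Fin d =>
      ((j : ℕ) : ℝ) + 1 ≤ (d : ℝ) - √(d : ℝ)).card ≤ (nullSet θ).card := by
    rw [card_rank_le]
    exact Nat.floor_le_of_le (le_card_nullSet hθ)
  have h := sum_sort_le (fun i => (θ i + σ * ξ i) ^ 2) (fun i => sq_nonneg _)
    (fun j : Fin d => ((j : ℕ) : ℝ) + 1 ≤ (d : ℝ) - √(d : ℝ))
    (fun i j hij hj => le_trans (by gcongr; exact_mod_cast hij) hj) (nullSet θ) hcard
  have h2 : ∑ i ∈ nullSet θ, (θ i + σ * ξ i) ^ 2 ≤ σ ^ 2 * ∑ j, ξ j ^ 2 := by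
    rw [Finset.mul_sum]
    refine (Finset.sum_congr rfl fun i hi => ?_).trans_le
      (Finset.sum_le_sum_of_subset_of_nonneg (f := fun i => σ ^ 2 * ξ i ^ 2)
        (Finset.subset_univ (nullSet θ)) fun i _ _ => by positivity)
    have : θ i = 0 := by simpa [nullSet] using hi
    rw [this]
    ring
  calc _ ≤ 9 / (d : ℝ) * (σ ^ 2 * ∑ j, ξ j ^ 2) :=
        mul_le_mul_of_nonneg_left (h.trans h2) (by positivity)
    _ = _ := by ring

/-- Chernoff bound in pointwise form: the right side dominates the indicator of `sigmaHat < σ` and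
has factors that are independent over coordinates. Each null noise of size at least `2/3` that
survives trimming adds at least `9 * (4/9) * σ² / d = 4σ²/d` to `sigmaHat²`, so there are at most
`d/4` of these; trimming hides at most `√d + 1` more. -/
lemma one_le_prod_of_sigmaHat_lt {d : ℕ} (hd : 0 < d) {θ : Fin d → ℝ} {σ : ℝ} (hσ : 0 < σ)
    {ξ : Fin d → ℝ} (h : sigmaHat (fun j => θ j + σ * ξ j) < σ) :
    1 ≤ (2 : ℝ) ^ ((d : ℝ) / 4 + √(d : ℝ) + 1) *
      ∏ i ∈ nullSet θ, if 2 / 3 ≤ |ξ i| then (1 / 2 : ℝ) else 1 := by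
  set N := (nullSet θ).filter fun i => 2 / 3 ≤ |ξ i| with hN
  have hd' : (0 : ℝ) < d := by exact_mod_cast hd
  have h1 := le_sum_sort (fun i => (θ i + σ * ξ i) ^ 2) (fun i => sq_nonneg _)
    (fun j : Fin d => ((j : ℕ) : ℝ) + 1 ≤ (d : ℝ) - √(d : ℝ)) N (4 / 9 * σ ^ 2) (by positivity) ?_
  swap
  · intro i hi
    obtain ⟨hi1, hi2⟩ := Finset.mem_filter.1 hi
    have h0 : θ i = 0 := by simpa [nullSet] using hi1
    have h3 : (2 / 3) ^ 2 ≤ |ξ i| ^ 2 := by gcongr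
    rw [sq_abs] at h3
    rw [h0, zero_add, mul_pow]
    nlinarith [sq_nonneg σ]
  have h2 : sigmaHat (fun j => θ j + σ * ξ j) ^ 2 < σ ^ 2 := by
    have := sigmaHat_nonneg fun j => θ j + σ * ξ j
    gcongr
  rw [sigmaHat_sq] at h2
  have h3 : 9 / (d : ℝ) * (4 / 9 * σ ^ 2 * ((N.card : ℝ) - (√(d : ℝ) + 1))) < σ ^ 2 := by
    refine lt_of_le_of_lt (mul_le_mul_of_nonneg_left (le_trans ?_ h1) (by positivity)) h2
    have := card_rank_gt_le d
    gcongr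
  have h4 : (N.card : ℝ) ≤ (d : ℝ) / 4 + √(d : ℝ) + 1 := by
    have h5 : 9 / (d : ℝ) * (4 / 9 * σ ^ 2 * ((N.card : ℝ) - (√(d : ℝ) + 1))) =
      σ ^ 2 * (4 * ((N.card : ℝ) - (√(d : ℝ) + 1)) / d) := by field_simp
    rw [h5] at h3
    have h6 := (mul_lt_iff_lt_one_right (by positivity)).1 h3
    rw [div_lt_one hd'] at h6
    linarith
  rw [Finset.prod_ite, Finset.prod_const, Finset.prod_const_one, mul_one, ← hN]
  have h7 : (2 : ℝ) ^ N.card ≤ (2 : ℝ) ^ ((d : ℝ) / 4 + √(d : ℝ) + 1) := by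
    rw [← Real.rpow_natCast]
    exact Real.rpow_le_rpow_of_exponent_le (by norm_num) h4
  calc (1 : ℝ) = 2 ^ N.card * (1 / 2) ^ N.card := by rw [← mul_pow]; norm_num
    _ ≤ _ := by gcongr

/-! ### Second moments of the kept noise on null coordinates. -/

/-- The noise in coordinate `j`, kept only when the observation exceeds the threshold. -/
noncomputable def keptNoise {d : ℕ} (θ : Fin d → ℝ) (σ t : ℝ) (j : Fin d) (ξ : Fin d → ℝ) : ℝ :=
  if sigmaHat (fun i => θ i + σ * ξ i) * t < |θ j + σ * ξ j| then ξ j else 0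

lemma measurable_keptNoise {d : ℕ} (θ : Fin d → ℝ) (σ t : ℝ) (j : Fin d) :
    Measurable (keptNoise θ σ t j) := by
  unfold keptNoise
  refine Measurable.ite (measurableSet_lt ?_ ?_) (by fun_prop) (by fun_prop)
  · exact (measurable_sigmaHat.comp (by fun_prop)).mul_const t
  · exact Measurable.abs (by fun_prop)

lemma abs_keptNoise_le {d : ℕ} (θ : Fin d → ℝ) (σ t : ℝ) (j : Fin d) (ξ : Fin d → ℝ) :
    |keptNoise θ σ t j ξ| ≤ |ξ j| := by
  unfold keptNoise
  split_ifs <;> simp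

lemma integrable_sq_eval {d : ℕ} (j : Fin d) :
    Integrable (fun ξ : Fin d → ℝ => ξ j ^ 2) (Measure.pi fun _ : Fin d => gaussianReal 0 1) :=
  integrable_comp_eval (μ := fun _ : Fin d => gaussianReal 0 1) (f := fun u : ℝ => u ^ 2)
    integrable_sq_gaussian

lemma integral_sq_eval {d : ℕ} (j : Fin d) :
    ∫ ξ, ξ j ^ 2 ∂(Measure.pi fun _ : Fin d => gaussianReal 0 1) = 1 :=
  (integral_comp_eval (μ := fun _ : Fin d => gaussianReal 0 1) (i := j) (f := fun u : ℝ => u ^ 2)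
    integrable_sq_gaussian.aestronglyMeasurable).trans integral_sq_gaussian

lemma integrable_keptNoise_mul {d : ℕ} (θ : Fin d → ℝ) (σ t : ℝ) (i j : Fin d) :
    Integrable (fun ξ => keptNoise θ σ t i ξ * keptNoise θ σ t j ξ)
      (Measure.pi fun _ : Fin d => gaussianReal 0 1) := by
  refine ((integrable_sq_eval i).add (integrable_sq_eval j)).mono'
    ((measurable_keptNoise θ σ t i).mul (measurable_keptNoise θ σ t j)).aestronglyMeasurable
    (Filter.Eventually.of_forall fun ξ => ?_)
  have h := mul_le_mul (abs_keptNoise_le θ σ t i ξ) (abs_keptNoise_le θ σ t j ξ) (abs_nonneg _)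
    (abs_nonneg _)
  rw [Real.norm_eq_abs, abs_mul, Pi.add_apply, ← sq_abs (ξ i), ← sq_abs (ξ j)]
  nlinarith [sq_nonneg (|ξ i| - |ξ j|), sq_nonneg (|ξ i| + |ξ j|)]

/-- As `θ j = 0`, flipping `ξ j` preserves every square `y_k²`, hence the threshold: the `j` factor
is odd in `ξ j`, the `i` factor even. -/
lemma integral_keptNoise_mul_eq_zero {d : ℕ} (θ : Fin d → ℝ) (σ t : ℝ) {i j : Fin d} (hij : i ≠ j)
    (hj : j ∈ nullSet θ) :
    ∫ ξ, keptNoise θ σ t i ξ * keptNoise θ σ t j ξ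
      ∂(Measure.pi fun _ : Fin d => gaussianReal 0 1) = 0 := by
  refine integral_eq_zero_of_odd j _
    ((measurable_keptNoise θ σ t i).mul (measurable_keptNoise θ σ t j)) fun ξ => ?_
  have h0 : θ j = 0 := by simpa [nullSet] using hj
  have hs : sigmaHat (fun k => θ k + σ * Function.update ξ j (-ξ j) k) =
      sigmaHat (fun k => θ k + σ * ξ k) := sigmaHat_congr fun k => by
    by_cases hk : k = j
    · subst hk
      simp [h0]
    · simp [hk]
  simp only [keptNoise, hs]
  simp only [Function.update_self, Function.update_of_ne hij, h0, zero_add, mul_neg, abs_neg]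
  split_ifs <;> simp

lemma integral_sum_keptNoise_sq {d : ℕ} (θ : Fin d → ℝ) (σ t : ℝ) :
    Integrable (fun ξ => (∑ j ∈ nullSet θ, keptNoise θ σ t j ξ) ^ 2)
      (Measure.pi fun _ : Fin d => gaussianReal 0 1) ∧
    ∫ ξ, (∑ j ∈ nullSet θ, keptNoise θ σ t j ξ) ^ 2
      ∂(Measure.pi fun _ : Fin d => gaussianReal 0 1) =
    ∑ j ∈ nullSet θ, ∫ ξ, keptNoise θ σ t j ξ ^ 2
      ∂(Measure.pi fun _ : Fin d => gaussianReal 0 1) := by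
  simp_rw [sq, Finset.sum_mul_sum]
  have hint := integrable_keptNoise_mul θ σ t
  refine ⟨integrable_finsetSum _ fun i _ => integrable_finsetSum _ fun j _ => hint i j, ?_⟩
  rw [integral_finsetSum _ fun i _ => integrable_finsetSum _ fun j _ => hint i j]
  refine Finset.sum_congr rfl fun i hi => ?_
  rw [integral_finsetSum _ fun j _ => hint i j]
  exact Finset.sum_eq_single_of_mem i hi fun j hj hji =>
    integral_keptNoise_mul_eq_zero θ σ t hji.symm hj

lemma integral_keptNoise_sq_le {d : ℕ} (hd : 0 < d) (θ : Fin d → ℝ) {σ t : ℝ} (hσ : 0 < σ)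
    (ht0 : 0 < t) (ht : 4 / 3 ≤ t ^ 2) {j : Fin d} (hj : j ∈ nullSet θ) :
    ∫ ξ, keptNoise θ σ t j ξ ^ 2 ∂(Measure.pi fun _ : Fin d => gaussianReal 0 1) ≤
      4 * t * Real.exp (-(t ^ 2 / 2)) +
        (2 : ℝ) ^ ((d : ℝ) / 4 + √(d : ℝ) + 1) * (77 / 100) ^ ((nullSet θ).card - 1) := by
  have h0 : θ j = 0 := by simpa [nullSet] using hj
  set P := fun ξ : Fin d → ℝ => ξ j ^ 2 *
    ∏ i ∈ (nullSet θ).erase j, if 2 / 3 ≤ |ξ i| then (1 / 2 : ℝ) else 1 with hP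
  obtain ⟨hPi, hPle⟩ := integral_sq_mul_prod_half_le j (nullSet θ) hj
  set A := (2 : ℝ) ^ ((d : ℝ) / 4 + √(d : ℝ) + 1) with hA
  have hA0 : 0 ≤ A := by positivity
  have hQ : Integrable (fun u : ℝ => if t < |u| then u ^ 2 else 0) (gaussianReal 0 1) := by
    refine integrable_sq_gaussian.mono' (Measurable.ite (measurableSet_lt measurable_const
      measurable_id.abs) (by fun_prop) (by fun_prop)).aestronglyMeasurable
      (Filter.Eventually.of_forall fun u => ?_)
    split_ifs
    · simp
    · simpa using sq_nonneg u
  have hQi := integrable_comp_eval (μ := fun _ : Fin d => gaussianReal 0 1) (i := j) hQ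
  have hQe := integral_comp_eval (μ := fun _ : Fin d => gaussianReal 0 1) (i := j)
    hQ.aestronglyMeasurable
  have hpt : ∀ ξ, keptNoise θ σ t j ξ ^ 2 ≤
      (if t < |ξ j| then ξ j ^ 2 else 0) + A * P ξ := by
    intro ξ
    have hprod : ∀ U : Finset (Fin d),
        0 ≤ ∏ i ∈ U, if 2 / 3 ≤ |ξ i| then (1 / 2 : ℝ) else 1 := fun U =>
      Finset.prod_nonneg fun i _ => by split_ifs <;> norm_num
    have hPn : 0 ≤ A * P ξ := mul_nonneg hA0 (mul_nonneg (sq_nonneg _) (hprod _))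
    have hQn : 0 ≤ if t < |ξ j| then ξ j ^ 2 else 0 := by split_ifs <;> positivity
    have hk : keptNoise θ σ t j ξ ^ 2 ≤ ξ j ^ 2 := sq_le_sq.2 (abs_keptNoise_le θ σ t j ξ)
    by_cases hlt : sigmaHat (fun i => θ i + σ * ξ i) < σ
    · have h1 := one_le_prod_of_sigmaHat_lt hd hσ hlt
      rw [← Finset.mul_prod_erase _ _ hj] at h1
      -- Dropping the factor at `j` leaves a product independent of `ξ j ^ 2`.
      have h2 : (if 2 / 3 ≤ |ξ j| then (1 / 2 : ℝ) else 1) ≤ 1 := by split_ifs <;> norm_num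
      have h3 := mul_le_of_le_one_left (hprod ((nullSet θ).erase j)) h2
      have h4 := h1.trans (mul_le_mul_of_nonneg_left h3 hA0)
      have h5 : ξ j ^ 2 ≤ A * P ξ := by
        calc ξ j ^ 2 ≤ ξ j ^ 2 * _ := le_mul_of_one_le_right (sq_nonneg _) h4
          _ = A * P ξ := by simp only [hP]; ring
      linarith
    · by_cases hth : t < |ξ j|
      · rw [if_pos hth]
        linarith
      · have : keptNoise θ σ t j ξ = 0 := by
          unfold keptNoise
          rw [if_neg]
          rw [h0, zero_add, abs_mul, abs_of_pos hσ, not_lt]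
          exact mul_le_mul (not_lt.1 hlt) (not_lt.1 hth) (abs_nonneg _) (sigmaHat_nonneg _)
        rw [this]
        simpa using add_nonneg hQn hPn
  calc ∫ ξ, keptNoise θ σ t j ξ ^ 2 ∂(Measure.pi fun _ : Fin d => gaussianReal 0 1)
      ≤ ∫ ξ, ((if t < |ξ j| then ξ j ^ 2 else 0) + A * P ξ)
          ∂(Measure.pi fun _ : Fin d => gaussianReal 0 1) :=
        integral_mono_of_nonneg (Filter.Eventually.of_forall fun ξ => sq_nonneg _)
          (hQi.add (hPi.const_mul A)) (Filter.Eventually.of_forall hpt)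
    _ = (∫ u, (if t < |u| then u ^ 2 else 0) ∂(gaussianReal 0 1)) +
          A * ∫ ξ, P ξ ∂(Measure.pi fun _ : Fin d => gaussianReal 0 1) := by
        rw [integral_add hQi (hPi.const_mul A), hQe, integral_const_mul]
    _ ≤ _ := add_le_add (integral_sq_tail_gaussian_le ht0 ht)
        (mul_le_mul_of_nonneg_left hPle hA0)

/-- In `x = √d` the logarithm is bounded by a quadratic with leading coefficient `-c`, where `c > 0`
because `2 * (77/100)^4 < 1`. Completing the square gives the constant. -/
lemma exists_bound_overestimation :
    ∃ K : ℝ, 0 < K ∧ ∀ d n : ℕ, (d : ℝ) - √(d : ℝ) ≤ n →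
      (d : ℝ) * ((2 : ℝ) ^ ((d : ℝ) / 4 + √(d : ℝ) + 1) * (77 / 100) ^ (n - 1)) ≤ K := by
  set l := Real.log 2
  set r := Real.log (77 / 100)
  have hr : r < 0 := Real.log_neg (by norm_num) (by norm_num)
  have hc : 0 < -(l / 4 + r) := by
    have h : Real.log (2 * (77 / 100) ^ 4) < 0 := Real.log_neg (by norm_num) (by norm_num)
    rw [Real.log_mul (by norm_num) (by norm_num), Real.log_pow] at h
    push_cast at h
    change l + 4 * r < 0 at h
    linarith
  set c := -(l / 4 + r) with hcdef
  refine ⟨Real.exp ((2 + l - r) ^ 2 / (4 * c) + (l - r)), Real.exp_pos _, fun d n hn => ?_⟩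
  set x := √(d : ℝ) with hx
  have hxd : (d : ℝ) = x ^ 2 := (Real.sq_sqrt (Nat.cast_nonneg d)).symm
  have hx0 : 0 ≤ x := Real.sqrt_nonneg _
  have h1 : (d : ℝ) ≤ Real.exp (2 * x) := by
    have : x ≤ Real.exp x := by linarith [Real.add_one_le_exp x]
    rw [hxd, two_mul, Real.exp_add, ← sq]
    gcongr
  have h2 : (2 : ℝ) ^ ((d : ℝ) / 4 + x + 1) = Real.exp (l * (x ^ 2 / 4 + x + 1)) := by
    rw [Real.rpow_def_of_pos (by norm_num), hxd]
  have h3 : (77 / 100 : ℝ) ^ (n - 1) ≤ Real.exp (r * (x ^ 2 - x - 1)) := by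
    rw [← Real.rpow_natCast, Real.rpow_def_of_pos (by norm_num)]
    refine Real.exp_le_exp.2 (mul_le_mul_of_nonpos_left ?_ hr.le)
    -- An inequality only: `n - 1` is truncated at `n = 0`.
    have : (n : ℝ) ≤ ((n - 1 : ℕ) : ℝ) + 1 := by
      have : n ≤ (n - 1) + 1 := by omega
      exact_mod_cast this
    linarith
  rw [h2]
  calc (d : ℝ) * (Real.exp (l * (x ^ 2 / 4 + x + 1)) * (77 / 100) ^ (n - 1))
      ≤ Real.exp (2 * x) *
          (Real.exp (l * (x ^ 2 / 4 + x + 1)) * Real.exp (r * (x ^ 2 - x - 1))) := by gcongr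
    _ = Real.exp (2 * x + (l * (x ^ 2 / 4 + x + 1) + r * (x ^ 2 - x - 1))) := by
        rw [Real.exp_add, Real.exp_add]
    _ ≤ _ := by
        refine Real.exp_le_exp.2 ?_
        have h4 : (2 + l - r) * x - c * x ^ 2 ≤ (2 + l - r) ^ 2 / (4 * c) := by
          rw [le_div_iff₀ (by positivity)]
          nlinarith [sq_nonneg (2 * c * x - (2 + l - r))]
        have h5 : 2 * x + (l * (x ^ 2 / 4 + x + 1) + r * (x ^ 2 - x - 1)) =
            (2 + l - r) * x - c * x ^ 2 + (l - r) := by rw [hcdef]; ring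
        linarith

/-! ### Error decomposition and the risk bound. -/

lemma linEstimator_sub_eq {d : ℕ} (s : ℕ) (θ ξ : Fin d → ℝ) {σ : ℝ} {t : ℝ}
    (ht : t = √(2 * Real.log (1 + (d : ℝ) / (s : ℝ) ^ 2))) :
    linEstimator s (fun j => θ j + σ * ξ j) - linFunctional θ =
      (∑ j ∈ (nullSet θ)ᶜ, ((if sigmaHat (fun i => θ i + σ * ξ i) * t < |θ j + σ * ξ j|
        then θ j + σ * ξ j else 0) - θ j)) + σ * ∑ j ∈ nullSet θ, keptNoise θ σ t j ξ := by
  unfold linEstimator linFunctional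
  rw [← ht, ← Finset.sum_sub_distrib, ← Finset.sum_compl_add_sum (nullSet θ), Finset.mul_sum]
  congr 1
  refine Finset.sum_congr rfl fun j hj => ?_
  have h0 : θ j = 0 := by simpa [nullSet] using hj
  unfold keptNoise
  simp [h0]

lemma card_compl_nullSet {d : ℕ} (θ : Fin d → ℝ) : (nullSet θ)ᶜ.card = hammingNorm θ := by
  have h := hammingNorm_add_card_nullSet θ
  rw [Finset.card_compl, Fintype.card_fin]
  omega

lemma abs_threshold_sub_le {θ z τ : ℝ} (hτ : 0 ≤ τ) :
    |(if τ < |θ + z| then θ + z else 0) - θ| ≤ |z| + τ := by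
  split_ifs with h
  · simpa using hτ
  · have h1 : |θ| ≤ |θ + z| + |z| := by simpa using abs_sub (θ + z) z
    rw [zero_sub, abs_neg]
    linarith [not_lt.1 h]

lemma sq_linEstimator_sub_le {d s : ℕ} (hs : (s : ℝ) ≤ √(d : ℝ)) {θ : Fin d → ℝ}
    (hθ : hammingNorm θ ≤ s) (ξ : Fin d → ℝ) {σ t : ℝ}
    (ht : t = √(2 * Real.log (1 + (d : ℝ) / (s : ℝ) ^ 2))) :
    (linEstimator s (fun j => θ j + σ * ξ j) - linFunctional θ) ^ 2 ≤
      4 * s * σ ^ 2 * ∑ j ∈ (nullSet θ)ᶜ, ξ j ^ 2 +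
      36 * s ^ 2 * t ^ 2 * σ ^ 2 / d * ∑ j, ξ j ^ 2 +
      2 * σ ^ 2 * (∑ j ∈ nullSet θ, keptNoise θ σ t j ξ) ^ 2 := by
  rw [linEstimator_sub_eq s θ ξ ht]
  have ht0 : 0 ≤ t := ht ▸ Real.sqrt_nonneg _
  have hθs : (hammingNorm θ : ℝ) ≤ s := by exact_mod_cast hθ
  set τ := sigmaHat (fun i => θ i + σ * ξ i) * t with hτ
  have hτ0 : 0 ≤ τ := mul_nonneg (sigmaHat_nonneg _) ht0
  set A := ∑ j ∈ (nullSet θ)ᶜ, ((if τ < |θ j + σ * ξ j| then θ j + σ * ξ j else 0) - θ j)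
  set B := ∑ j ∈ nullSet θ, keptNoise θ σ t j ξ
  have hτ2 : τ ^ 2 ≤ 9 * σ ^ 2 / d * (∑ j, ξ j ^ 2) * t ^ 2 := by
    rw [hτ, mul_pow]
    exact mul_le_mul_of_nonneg_right (sigmaHat_sq_le (hθs.trans hs) σ ξ) (sq_nonneg t)
  have hA : A ^ 2 ≤ 2 * s * σ ^ 2 * ∑ j ∈ (nullSet θ)ᶜ, ξ j ^ 2 + 2 * s ^ 2 * τ ^ 2 := by
    calc A ^ 2 ≤ (nullSet θ)ᶜ.card * ∑ j ∈ (nullSet θ)ᶜ,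
          ((if τ < |θ j + σ * ξ j| then θ j + σ * ξ j else 0) - θ j) ^ 2 :=
          sq_sum_le_card_mul_sum_sq
      _ ≤ s * ∑ j ∈ (nullSet θ)ᶜ, (2 * σ ^ 2 * ξ j ^ 2 + 2 * τ ^ 2) := by
          rw [card_compl_nullSet]
          refine mul_le_mul hθs (Finset.sum_le_sum fun j _ => ?_)
            (Finset.sum_nonneg fun j _ => sq_nonneg _) (Nat.cast_nonneg s)
          have h := pow_le_pow_left₀ (abs_nonneg _)
            (abs_threshold_sub_le (θ := θ j) (z := σ * ξ j) hτ0) 2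
          rw [sq_abs] at h
          nlinarith [sq_nonneg (|σ * ξ j| - τ), sq_abs (σ * ξ j)]
      _ = s * (2 * σ ^ 2 * ∑ j ∈ (nullSet θ)ᶜ, ξ j ^ 2) + s * hammingNorm θ * (2 * τ ^ 2) := by
          rw [Finset.sum_add_distrib, ← Finset.mul_sum, Finset.sum_const, card_compl_nullSet,
            nsmul_eq_mul]
          ring
      _ ≤ s * (2 * σ ^ 2 * ∑ j ∈ (nullSet θ)ᶜ, ξ j ^ 2) + s * s * (2 * τ ^ 2) := by gcongr
      _ = _ := by ring
  have h2 : 4 * (s : ℝ) ^ 2 * τ ^ 2 ≤ 36 * s ^ 2 * t ^ 2 * σ ^ 2 / d * ∑ j, ξ j ^ 2 := by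
    calc 4 * (s : ℝ) ^ 2 * τ ^ 2 ≤ 4 * (s : ℝ) ^ 2 * (9 * σ ^ 2 / d * (∑ j, ξ j ^ 2) * t ^ 2) := by
          gcongr
      _ = _ := by ring
  -- This is `(A + σB)² ≤ 2A² + 2σ²B²`.
  nlinarith [sq_nonneg (A - σ * B)]

lemma sqRisk_le {d s : ℕ} (hs : (s : ℝ) ≤ √(d : ℝ)) {θ : Fin d → ℝ} (hθ : hammingNorm θ ≤ s)
    {σ t E : ℝ} (hd : 0 < d)
    (ht : t = √(2 * Real.log (1 + (d : ℝ) / (s : ℝ) ^ 2)))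
    (hE : ∀ j ∈ nullSet θ, ∫ ξ, keptNoise θ σ t j ξ ^ 2
      ∂(Measure.pi fun _ : Fin d => gaussianReal 0 1) ≤ E) (hE0 : 0 ≤ E) :
    sqRisk σ (linEstimator s) θ ≤ ENNReal.ofReal (4 * s ^ 2 * σ ^ 2 +
      36 * s ^ 2 * t ^ 2 * σ ^ 2 + 2 * σ ^ 2 * (d * E)) := by
  have hd' : (0 : ℝ) < d := by exact_mod_cast hd
  have hθs : (hammingNorm θ : ℝ) ≤ s := by exact_mod_cast hθ
  obtain ⟨hB, hBeq⟩ := integral_sum_keptNoise_sq θ σ t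
  set μ := Measure.pi fun _ : Fin d => gaussianReal 0 1
  have h1 : Integrable (fun ξ : Fin d → ℝ => 4 * s * σ ^ 2 * ∑ j ∈ (nullSet θ)ᶜ, ξ j ^ 2) μ :=
    (integrable_finsetSum _ fun j _ => integrable_sq_eval j).const_mul _
  have h2 : Integrable (fun ξ : Fin d → ℝ =>
      36 * s ^ 2 * t ^ 2 * σ ^ 2 / d * ∑ j, ξ j ^ 2) μ :=
    (integrable_finsetSum _ fun j _ => integrable_sq_eval j).const_mul _
  have h3 := hB.const_mul (2 * σ ^ 2)
  unfold sqRisk obsLaw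
  -- Only an upper bound is needed, so the loss need not be shown measurable.
  refine (lintegral_map_le _ _).trans ?_
  refine (lintegral_mono fun ξ => ENNReal.ofReal_le_ofReal
    (sq_linEstimator_sub_le hs hθ ξ ht)).trans ?_
  have hF : Integrable (fun ξ : Fin d → ℝ => 4 * s * σ ^ 2 * ∑ j ∈ (nullSet θ)ᶜ, ξ j ^ 2 +
      36 * s ^ 2 * t ^ 2 * σ ^ 2 / d * ∑ j, ξ j ^ 2 +
      2 * σ ^ 2 * (∑ j ∈ nullSet θ, keptNoise θ σ t j ξ) ^ 2) μ := (h1.add h2).add h3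
  refine (ofReal_integral_eq_lintegral_ofReal hF
    (Filter.Eventually.of_forall fun ξ => ?_)).symm.le.trans ?_
  · have := Finset.sum_nonneg fun j (_ : j ∈ (nullSet θ)ᶜ) => sq_nonneg (ξ j)
    have := Finset.sum_nonneg fun j (_ : j ∈ Finset.univ) => sq_nonneg (ξ j)
    simp only [Pi.zero_apply]
    positivity
  refine ENNReal.ofReal_le_ofReal ?_
  rw [integral_add (h1.fun_add h2) h3, integral_add h1 h2, integral_const_mul, integral_const_mul,
    integral_const_mul, hBeq, integral_finsetSum _ fun j _ => integrable_sq_eval j,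
    integral_finsetSum _ fun j _ => integrable_sq_eval j]
  simp_rw [μ, integral_sq_eval]
  have hsum : ∑ j ∈ nullSet θ, ∫ ξ, keptNoise θ σ t j ξ ^ 2 ∂μ ≤ d * E := by
    calc _ ≤ (nullSet θ).card • E := Finset.sum_le_card_nsmul _ _ _ hE
      _ ≤ d * E := by
        rw [nsmul_eq_mul]
        gcongr
        simpa using Finset.card_le_univ (nullSet θ)
  rw [Finset.sum_const, Finset.sum_const, card_compl_nullSet, Finset.card_univ, Fintype.card_fin,
    nsmul_eq_mul, nsmul_eq_mul, mul_one, mul_one, div_mul_cancel₀ _ hd'.ne']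
  have h4 : 4 * s * σ ^ 2 * (hammingNorm θ : ℝ) ≤ 4 * s ^ 2 * σ ^ 2 := by
    calc _ ≤ 4 * s * σ ^ 2 * (s : ℝ) := by gcongr
      _ = _ := by ring
  gcongr

end SparseMean

theorem theorem8 :
    ∃ C : ℝ, 0 < C ∧ ∀ d s : ℕ, 3 ≤ d → 1 ≤ s → (s : ℝ) ≤ √(d : ℝ) → ∀ σ : ℝ, 0 < σ →
      ⨆ θ ∈ SparseMean.B0 d s, SparseMean.sqRisk σ (SparseMean.linEstimator s) θ
        ≤ ENNReal.ofReal (C * SparseMean.linRate σ s d) := by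
  open SparseMean in
  obtain ⟨K, hK, hKd⟩ := exists_bound_overestimation
  -- `96 = 8 + 72 + 16`: support noise, threshold, Gaussian tail. The rare event adds `2σ²K`, at
  -- most `4K` times the rate since `2s²x ≥ 1`.
  refine ⟨96 + 4 * K, by positivity, fun d s hd hs1 hs σ hσ => iSup₂_le fun θ hθ => ?_⟩
  have hθ' : hammingNorm θ ≤ s := hθ
  have hd0 : 0 < d := by omega
  have hd' : (0 : ℝ) < d := by exact_mod_cast hd0
  have hs' : (1 : ℝ) ≤ s := by exact_mod_cast hs1
  have hs2 : (s : ℝ) ^ 2 ≤ d := (Real.le_sqrt' (by linarith)).1 hs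
  set x := Real.log (1 + (d : ℝ) / (s : ℝ) ^ 2) with hx
  have hq : 1 ≤ (d : ℝ) / (s : ℝ) ^ 2 := (one_le_div (by positivity)).2 hs2
  have hx2 : 2 / 3 ≤ x := by
    have : Real.log 2 ≤ x := Real.log_le_log (by norm_num) (by linarith)
    linarith [Real.log_two_gt_d9]
  set t := √(2 * x) with ht
  have ht2 : t ^ 2 = 2 * x := Real.sq_sqrt (by linarith)
  have ht0 : 0 < t := Real.sqrt_pos.2 (by linarith)
  -- Since `t² = 2x ≥ 4/3`, one has `t ≥ 1` and so `t ≤ t²`; this absorbs the factor `t` of the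
  -- Gaussian tail.
  have htx : t ≤ 2 * x := by nlinarith
  have hexp : (d : ℝ) * Real.exp (-(t ^ 2 / 2)) ≤ (s : ℝ) ^ 2 := by
    rw [ht2, mul_div_cancel_left₀ _ (two_ne_zero), Real.exp_neg, hx, Real.exp_log (by positivity),
      ← div_eq_mul_inv, div_le_iff₀ (by positivity)]
    have : (s : ℝ) ^ 2 * (1 + (d : ℝ) / (s : ℝ) ^ 2) = s ^ 2 + d := by field_simp
    rw [this]
    linarith [sq_nonneg (s : ℝ)]
  have hnull := le_card_nullSet (θ := θ) (le_trans (by exact_mod_cast hθ') hs)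
  have hKd' := hKd d _ hnull
  refine (sqRisk_le hs hθ' hd0 ht
    (fun j hj => integral_keptNoise_sq_le hd0 θ hσ ht0 (by linarith) hj) (by positivity)).trans
    (ENNReal.ofReal_le_ofReal ?_)
  unfold linRate
  rw [← hx, ht2]
  have hmain : (d : ℝ) * (4 * t * Real.exp (-(2 * x / 2)) +
      (2 : ℝ) ^ ((d : ℝ) / 4 + √(d : ℝ) + 1) * (77 / 100) ^ ((nullSet θ).card - 1)) ≤
      8 * x * s ^ 2 + K := by
    rw [ht2] at hexp
    have : 4 * t * (d * Real.exp (-(2 * x / 2))) ≤ 4 * (2 * x) * s ^ 2 := by gcongr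
    linarith
  have hone : 1 ≤ 2 * (s : ℝ) ^ 2 * x := by nlinarith
  have h1 : 4 * (s : ℝ) ^ 2 * σ ^ 2 ≤ 8 * (σ ^ 2 * s ^ 2 * x) := by
    have : 0 ≤ σ ^ 2 * (s : ℝ) ^ 2 := by positivity
    nlinarith
  have h2 : σ ^ 2 * K * 1 ≤ σ ^ 2 * K * (2 * (s : ℝ) ^ 2 * x) := by gcongr
  have h3 := mul_le_mul_of_nonneg_left hmain (by positivity : 0 ≤ 2 * σ ^ 2)
  linarith
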